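/- Let $p$ be an odd prime and fix once and for all a unit $q\in\mathbb Z_p^\times$ that is not a square. Let $M$ be a commutative, associative (non-unital) $\mathbb Z_p$-algebra which is finitely generated and torsion as a $\mathbb Z_p$-module, satisfies $M\cdot M\cdot M=0$, and whose square $M\cdot M$ (the submodule generated by all products) is isomorphic to $\mathbb Z_p/p^t\mathbb Z_p$ with $t>0$. Let $\mathrm{Ann}(M)=\{a\in M : a\cdot x=0 \text{ for all } x\in M\}$, and let $b\colon M/\mathrm{Ann}(M)\times M/\mathrm{Ann}(M)\to M\cdot M$ be the symmetric bilinear map induced by the product. A \emph{covering} of $M$ is a pair $(\overline M,\bar b)$, where $\overline M$ is a finitely generated free $\mathbb Z_p$-module and $\bar b\colon\overline M\times\overline M\to\mathbb Z_p$ is a symmetric bilinear form, for which there are a surjective linear map $\pi\colon\overline M\to M/\mathrm{Ann}(M)$ and a surjective linear map $\Theta\colon\mathbb Z_p\to M\cdot M$ with kernel $p^t\mathbb Z_p$ (reduction modulo $p^t$) such that $\Theta(\bar b(x,y))=b(\pi(x),\pi(y))$ for all $x,y\in\overline M$. A \emph{Jordan decomposition} of $(\overline M,\bar b)$ is a sequence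 $(\bar b_0,\bar b_1,\bar b_2,\dots)$, where $\bar b_i$ is the form on $\mathbb Z_p^{n_i}$ with matrix $p^i\,\mathrm{diag}(1,\dots,1,\varepsilon_i)$, $n_i\ge 0$, $\varepsilon_i\in\{1,q\}$, such that $(\overline M,\bar b)$ is isometric to the orthogonal sum of all the $\bar b_i$ and of a (possibly zero) module with the zero form; here an isometry is an isomorphism that preserves the forms up to multiplication by a unit of $\mathbb Z_p$. We write $\mathrm{rk}(\bar b_i)=n_i$, and call $(\bar b_0,\dots,\bar b_{t-1})$ a Jordan decomposition \emph{modulo $p^t$}. Let $(\overline M,\bar b)$ and $(\overline N,\bar g)$ be two coverings of $M$, with Jordan decompositions modulo $p^t$ respectively $(\bar b_0,\dots,\bar b_{t-1})$ and $(\bar g_0,\dots,\bar g_{t-1})$. Then: 1. $\mathrm{rk}(\bar b_i)=\mathrm{rk}(\bar g_i)$ for each $i=0,\dots,t-1$; 2. for each $i=0,\dots,t-1$, if $\mathrm{rk}(\bar b_i)=\mathrm{rk}(\bar g_i)$ is even, then $\bar b_i=\bar g_i$. -/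

import Mathlib

section Algebra

variable (R A : Type*) [CommRing R] [NonUnitalCommRing A] [Module R A]
  [IsScalarTower R A A] [SMulCommClass R A A]

/-- The annihilator `Ann(A) = {a | a * x = 0 for all x}` of a commutative `R`-algebra `A`. -/
def algAnn : Submodule R A where
  carrier := {a | ∀ x : A, a * x = 0}
  zero_mem' := fun x => zero_mul x
  add_mem' := fun {a b} ha hb x => by rw [add_mul, ha x, hb x, add_zero]
  smul_mem' := fun r a ha x => by rw [smul_mul_assoc, ha x, smul_zero]

/-- The submodule `A · A`, generated by all the products. -/
def algSq : Submodule R A :=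
  Submodule.span R (Set.range fun z : A × A => z.1 * z.2)

/-- The product of `A`, as a bilinear map `A × A → A · A`. -/
def mulToSq : A →ₗ[R] A →ₗ[R] algSq R A :=
  LinearMap.mk₂ R (fun x y => ⟨x * y, Submodule.subset_span ⟨(x, y), rfl⟩⟩)
    (fun x y z => Subtype.ext (add_mul x y z))
    (fun r x y => Subtype.ext (smul_mul_assoc r x y))
    (fun x y z => Subtype.ext (mul_add x y z))
    (fun r x y => Subtype.ext (mul_smul_comm r x y))

/-- The bilinear map `b : A/Ann(A) × A/Ann(A) → A · A` induced by the product of `A`. -/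
def productForm : (A ⧸ algAnn R A) →ₗ[R] (A ⧸ algAnn R A) →ₗ[R] algSq R A :=
  (algAnn R A).liftQ
    ((algAnn R A).liftQ (mulToSq R A).flip
      (fun a ha => LinearMap.ext fun x =>
        Subtype.ext ((mul_comm x a).trans (ha x)))).flip
    (fun a ha => LinearMap.ext fun y => by
      obtain ⟨y, rfl⟩ := Submodule.mkQ_surjective _ y
      exact Subtype.ext (ha y))

theorem coe_productForm_mk (x y : A) :
    ((productForm R A (Submodule.Quotient.mk x) (Submodule.Quotient.mk y) : algSq R A) : A)
      = x * y := rfl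

end Algebra

section Lattice

variable (p : ℕ) [Fact p.Prime]

/-- The lattice `(M, b)` is a covering of the `ℤ_p`-algebra `A`, where `A · A ≅ ℤ_p / p^t ℤ_p`:
`b` is a symmetric bilinear form on `M`, and there are a surjective linear map
`π : M → A / Ann(A)` and an identification `φ` of `ℤ_p / p^t ℤ_p` with `A · A` such that
reducing `b x y` modulo `p ^ t` gives the product of `π x` and `π y`. -/
def IsCovering (t : ℕ) (A : Type*) [NonUnitalCommRing A] [Module ℤ_[p] A]
    [IsScalarTower ℤ_[p] A A] [SMulCommClass ℤ_[p] A A]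
    {M : Type*} [AddCommGroup M] [Module ℤ_[p] M] (b : LinearMap.BilinForm ℤ_[p] M) : Prop :=
  (∀ x y : M, b x y = b y x) ∧
  ∃ π : M →ₗ[ℤ_[p]] (A ⧸ algAnn ℤ_[p] A), Function.Surjective π ∧
  ∃ φ : (ℤ_[p] ⧸ Ideal.span {(p : ℤ_[p]) ^ t}) ≃ₗ[ℤ_[p]] algSq ℤ_[p] A,
    ∀ x y : M, φ (Ideal.Quotient.mk _ (b x y)) = productForm ℤ_[p] A (π x) (π y)

/-- The `n × n` matrix `p ^ i * diag(1, …, 1, ε)`. -/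
noncomputable def jordanBlock (i n : ℕ) (ε : ℤ_[p]) : Matrix (Fin n) (Fin n) ℤ_[p] :=
  Matrix.diagonal fun k => (p : ℤ_[p]) ^ i * if (k : ℕ) + 1 = n then ε else 1

/-- A bilinear form on some `ℤ_p ^ n`, given by its rank `n` and its matrix. -/
abbrev FormMatrix : Type := Σ n : ℕ, Matrix (Fin n) (Fin n) ℤ_[p]

variable {p}

/-- The rank of the free module that carries the form. -/
def FormMatrix.rk (c : FormMatrix p) : ℕ := c.1

variable {M : Type*} [AddCommGroup M] [Module ℤ_[p] M]

/-- `(c 0, c 1, c 2, …)` is a Jordan decomposition of the lattice `(M, b)`, where `q` is the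
pre-selected non-square unit: the component `c i` is `p ^ i * diag(1, …, 1, ε)` with `ε = 1` or
`ε = q` (possibly of rank zero), and `(M, b)` is isometric to the orthogonal sum of the `c i` and
of a zero form (the radical; `r = 0` exactly for regular lattices). Isometries preserve the form
up to an invertible scalar `u`. -/
def IsJordanDecomposition (q : ℤ_[p]) (b : LinearMap.BilinForm ℤ_[p] M)
    (c : ℕ → FormMatrix p) : Prop :=
  (∀ i, ∃ ε : ℤ_[p], (ε = 1 ∨ ε = q) ∧ (c i).2 = jordanBlock p i (c i).1 ε) ∧
  ∃ (r : ℕ) (v : Module.Basis ((Σ i : ℕ, Fin (c i).1) ⊕ Fin r) ℤ_[p] M) (u : ℤ_[p]ˣ),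
    ∀ j k, b (v j) (v k) =
      (u : ℤ_[p]) * Matrix.fromBlocks (Matrix.blockDiagonal' fun i => (c i).2) 0 0 0 j k

/-- `(c 0, …, c (t - 1))` is a Jordan decomposition modulo `p ^ t` of `(M, b)`: it consists of the
components of scale dividing `p ^ (t - 1)` of a Jordan decomposition of `(M, b)`. -/
def IsJordanDecompositionMod (q : ℤ_[p]) (t : ℕ) (b : LinearMap.BilinForm ℤ_[p] M)
    (c : Fin t → FormMatrix p) : Prop :=
  ∃ c' : ℕ → FormMatrix p, IsJordanDecomposition q b c' ∧ ∀ i : Fin t, c i = c' i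

end Lattice

/-!
Let `φ_b, φ_g : ℤ_p / p ^ t ≃ A · A` be the identifications belonging to the two coverings. They
differ by a scalar `w` that is a unit modulo `p`, so that `g z z' ≡ w * b x x'` modulo `p ^ t`
whenever `z, z'` and `x, x'` have the same images in `A / Ann(A)` (`IsCovering.exists_unit_congr`).

Fix `i < t` and lift the images of the Jordan basis vectors of `M` of scale `p ^ i` to vectors
`z k` of `N`. As `b (x k)` has values in `p ^ i ℤ_p`, so has `g (z k)`. This divisibility forces the
coordinates of `z k` along the Jordan components of `N` of scale `p ^ j`, `j < i`, to be divisible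
by `p ^ (i - j)`; therefore only the component of scale `p ^ i` contributes to `g (z k) (z l)`
modulo `p ^ (i + 1)`. After division by `p ^ i` one gets, over `ZMod p`, a matrix identity
`s • D = s' • (Fᵀ * D' * F)` with scalars `s ≠ 0` and `s'`, where `D`, `D'` are the diagonal matrices
of the two `i`-th components, of ranks `n`, `n'` and last entries `ε`, `ε'`
(`exists_matrix_congr`).

Since `D` is invertible, comparing ranks gives `n ≤ n'`, and equality follows by symmetry. Comparing
determinants gives `s ^ n * ε = s' ^ n * ε' * det F ^ 2`; if `n` is even, then `ε` and `ε'` have the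
same class modulo squares in `ZMod p`, and by Hensel's lemma, `p` being odd, this class
distinguishes `1` from the nonsquare unit `q`.
-/

/-! ### Reduction modulo `p` -/

section Residue

variable {p : ℕ} [Fact p.Prime]

theorem PadicInt.toZMod_eq_zero_iff (x : ℤ_[p]) : PadicInt.toZMod x = 0 ↔ (p : ℤ_[p]) ∣ x := by
  rw [← RingHom.mem_ker, PadicInt.ker_toZMod, PadicInt.maximalIdeal_eq_span_p,
    Ideal.mem_span_singleton]

theorem PadicInt.toZMod_ne_zero_of_isUnit {x : ℤ_[p]} (hx : IsUnit x) :
    PadicInt.toZMod x ≠ 0 :=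
  (hx.map PadicInt.toZMod).ne_zero

/-- Hensel's lemma for `X ^ 2 - x`: for odd `p`, squares of units lift from `ZMod p` to `ℤ_p`. -/
theorem PadicInt.isSquare_of_isSquare_toZMod (hp : p ≠ 2) {x : ℤ_[p]} (hx : IsUnit x)
    (h : IsSquare (PadicInt.toZMod x)) : IsSquare x := by
  obtain ⟨s, hs⟩ := h
  obtain ⟨a, rfl⟩ := ZMod.ringHom_surjective PadicInt.toZMod s
  have h2 : ‖(2 : ℤ_[p])‖ = 1 := by
    have := (PadicInt.isUnit_iff (z := ((2 : ℕ) : ℤ_[p]))).1 (by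
      rw [PadicInt.isUnit_iff, PadicInt.norm_natCast_eq_one_iff]
      exact (Nat.coprime_primes Fact.out Nat.prime_two).2 hp)
    simpa using this
  have ha : ‖a‖ = 1 := by
    refine le_antisymm (PadicInt.norm_le_one a) (not_lt.1 fun hlt => ?_)
    rw [PadicInt.norm_lt_one_iff_dvd, ← PadicInt.toZMod_eq_zero_iff] at hlt
    exact PadicInt.toZMod_ne_zero_of_isUnit hx (by rw [hs, hlt, zero_mul])
  obtain ⟨z, hz, -⟩ := hensels_lemma (p := p) (R := ℤ_[p])
    (F := Polynomial.X ^ 2 - Polynomial.C x) (a := a) (by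
      have h1 : ‖a ^ 2 - x‖ < 1 := by
        rw [PadicInt.norm_lt_one_iff_dvd, ← PadicInt.toZMod_eq_zero_iff, map_sub, map_pow, hs]
        ring
      simpa [Polynomial.derivative_X_pow, h2, ha, one_add_one_eq_two] using h1)
  refine ⟨z, ?_⟩
  simp only [map_sub, map_pow, Polynomial.aeval_X, Polynomial.aeval_C, Algebra.algebraMap_self,
    RingHom.id_apply] at hz
  rw [← sub_eq_zero.1 hz, sq]

end Residue

/-! ### Diagonal bilinear forms -/

section Diagonal

variable {R M ι : Type*} [CommRing R] [AddCommGroup M] [Module R M] [DecidableEq ι]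
  {b : LinearMap.BilinForm R M} {v : Module.Basis ι R M} {d : ι → R}

theorem LinearMap.BilinForm.apply_basis_of_diagonal [Finite ι]
    (h : ∀ j k, b (v j) (v k) = if j = k then d j else 0) (x : M) (j : ι) :
    b x (v j) = d j * v.repr x j := by
  have := Fintype.ofFinite ι
  calc b x (v j) = b (∑ k, v.repr x k • v k) (v j) := by rw [v.sum_repr]
    _ = d j * v.repr x j := by simp [-Module.Basis.sum_repr, h, mul_comm]

theorem LinearMap.BilinForm.apply_eq_sum_of_diagonal [Fintype ι]
    (h : ∀ j k, b (v j) (v k) = if j = k then d j else 0) (x y : M) :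
    b x y = ∑ j, d j * v.repr x j * v.repr y j := by
  conv_lhs => rw [← v.sum_repr y]
  simp only [map_sum, map_smul, smul_eq_mul, apply_basis_of_diagonal h]
  exact Finset.sum_congr rfl fun j _ => mul_comm _ _

end Diagonal

/-! ### Diagonal entries of Jordan components -/

section Jordan

variable {p : ℕ} [Fact p.Prime]

/-- The `k`-th entry of `diag(1, …, 1, ε)`, a matrix of size `n`. -/
def jordanEntry {R : Type*} [One R] (n : ℕ) (ε : R) (k : Fin n) : R :=
  if (k : ℕ) + 1 = n then ε else 1

theorem map_jordanEntry {R S : Type*} [Semiring R] [Semiring S] (f : R →+* S) (n : ℕ) (ε : R)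
    (k : Fin n) : f (jordanEntry n ε k) = jordanEntry n (f ε) k := by
  unfold jordanEntry
  split_ifs <;> simp

theorem isUnit_jordanEntry {R : Type*} [Monoid R] {ε : R} (hε : IsUnit ε) (n : ℕ) (k : Fin n) :
    IsUnit (jordanEntry n ε k) := by
  unfold jordanEntry
  split_ifs <;> simp [hε]

theorem prod_jordanEntry {R : Type*} [CommMonoid R] {n : ℕ} (hn : n ≠ 0) (ε : R) :
    ∏ k, jordanEntry n ε k = ε := by
  obtain ⟨m, rfl⟩ := Nat.exists_eq_succ_of_ne_zero hn
  rw [Fin.prod_univ_castSucc, Finset.prod_eq_one fun k _ => ?_]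
  · simp [jordanEntry]
  · simp [jordanEntry, k.2.ne]

/-- The diagonal entries, up to the common scalar, of a form with Jordan components of ranks `n i`
and last entries `ε i`, and with a radical of rank `r`. -/
noncomputable def jordanWeight (n : ℕ → ℕ) (ε : ℕ → ℤ_[p]) (r : ℕ) :
    (Σ i : ℕ, Fin (n i)) ⊕ Fin r → ℤ_[p] :=
  Sum.elim (fun j => (p : ℤ_[p]) ^ j.1 * jordanEntry (n j.1) (ε j.1) j.2) 0

variable {M : Type*} [AddCommGroup M] [Module ℤ_[p] M]

theorem IsJordanDecomposition.exists_diagonal {q : ℤ_[p]} {b : LinearMap.BilinForm ℤ_[p] M}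
    {c : ℕ → FormMatrix p} (h : IsJordanDecomposition q b c) :
    ∃ ε : ℕ → ℤ_[p], (∀ i, (ε i = 1 ∨ ε i = q) ∧ (c i).2 = jordanBlock p i (c i).1 (ε i)) ∧
      ∃ (r : ℕ) (v : Module.Basis ((Σ i : ℕ, Fin (c i).1) ⊕ Fin r) ℤ_[p] M) (u : ℤ_[p]ˣ),
        ∀ j k, b (v j) (v k) = if j = k then u * jordanWeight (fun i => (c i).1) ε r j else 0 := by
  obtain ⟨hc, r, v, u, hv⟩ := h
  choose ε hε using hc
  refine ⟨ε, hε, r, v, u, fun j k => ?_⟩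
  rw [hv]
  obtain ⟨i, j⟩ | j := j <;> obtain ⟨i', k⟩ | k := k
  · rw [Matrix.fromBlocks_apply₁₁]
    by_cases hi : i = i'
    · subst hi
      rw [Matrix.blockDiagonal'_apply_eq, (hε i).2, jordanBlock, Matrix.diagonal_apply]
      by_cases hjk : j = k
      · subst hjk
        simp [jordanWeight, jordanEntry]
      · simp [hjk]
    · rw [Matrix.blockDiagonal'_apply_ne _ _ _ hi, if_neg (by simp [hi]), mul_zero]
  · simp
  · simp
  · simp [jordanWeight]

theorem FormMatrix.eq_of_eq_jordanBlock {c c' : FormMatrix p} {i : ℕ} {ε : ℤ_[p]}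
    (hn : c.1 = c'.1) (hc : c.2 = jordanBlock p i c.1 ε) (hc' : c'.2 = jordanBlock p i c'.1 ε) :
    c = c' := by
  obtain ⟨n, m⟩ := c
  obtain ⟨n', m'⟩ := c'
  obtain rfl : n = n' := hn
  rw [show m = _ from hc, show m' = _ from hc']

theorem jordanBlock_eq_of_eq_zero {n : ℕ} (hn : n = 0) (i : ℕ) (ε ε' : ℤ_[p]) :
    jordanBlock p i n ε = jordanBlock p i n ε' := by
  subst hn
  ext k
  exact k.elim0

/-- If `b x` and `b y` have values in `p ^ i ℤ_p`, then only the component of scale `p ^ i` of a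
Jordan decomposition contributes to `b x y` modulo `p ^ (i + 1)`. -/
theorem pow_succ_dvd_apply_sub_sum {n : ℕ → ℕ} {ε : ℕ → ℤ_[p]} (hε : ∀ i, IsUnit (ε i)) {r : ℕ}
    {b : LinearMap.BilinForm ℤ_[p] M} [Module.Finite ℤ_[p] M]
    {v : Module.Basis ((Σ i : ℕ, Fin (n i)) ⊕ Fin r) ℤ_[p] M} {u : ℤ_[p]ˣ}
    (hv : ∀ j k, b (v j) (v k) = if j = k then u * jordanWeight n ε r j else 0)
    {i : ℕ} {x y : M} (hx : ∀ z, (p : ℤ_[p]) ^ i ∣ b x z) (hy : ∀ z, (p : ℤ_[p]) ^ i ∣ b y z) :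
    (p : ℤ_[p]) ^ (i + 1) ∣ b x y - p ^ i * ∑ k : Fin (n i), u * jordanEntry (n i) (ε i) k *
      v.repr x (.inl ⟨i, k⟩) * v.repr y (.inl ⟨i, k⟩) := by
  classical
  have := Module.Finite.finite_basis v
  have := Fintype.ofFinite ((Σ i : ℕ, Fin (n i)) ⊕ Fin r)
  let e : Fin (n i) ↪ (Σ i : ℕ, Fin (n i)) ⊕ Fin r :=
    (Function.Embedding.sigmaMk (β := fun i => Fin (n i)) i).trans .inl
  rw [LinearMap.BilinForm.apply_eq_sum_of_diagonal hv,
    ← Finset.sum_add_sum_compl (Finset.univ.map e), Finset.sum_map, Finset.mul_sum]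
  have heq : ∀ k : Fin (n i), u * jordanWeight n ε r (e k) * v.repr x (e k) * v.repr y (e k) =
      (p : ℤ_[p]) ^ i * (u * jordanEntry (n i) (ε i) k *
        v.repr x (.inl ⟨i, k⟩) * v.repr y (.inl ⟨i, k⟩)) := by
    intro k
    simp only [jordanWeight, e, Function.Embedding.trans_apply, Function.Embedding.sigmaMk_apply,
      Function.Embedding.inl_apply, Sum.elim_inl]
    ring
  rw [Finset.sum_congr rfl fun k _ => heq k, add_sub_cancel_left]
  refine Finset.dvd_sum fun j hj => ?_
  obtain ⟨m, k⟩ | j := j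
  · have hm : m ≠ i := by
      rintro rfl
      simp [e] at hj
    rcases lt_or_gt_of_ne hm with hlt | hgt
    · -- Both coordinates are divisible by `p ^ (i - m)`, and `m + 2 * (i - m) ≥ i + 1`.
      have key : ∀ z : M, (∀ y, (p : ℤ_[p]) ^ i ∣ b z y) →
          (p : ℤ_[p]) ^ (i - m) ∣ v.repr z (.inl ⟨m, k⟩) := by
        intro z hz
        have h := hz (v (.inl ⟨m, k⟩))
        rw [LinearMap.BilinForm.apply_basis_of_diagonal hv] at h
        have h' : (p : ℤ_[p]) ^ m * p ^ (i - m) ∣ p ^ m *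
            (u * jordanEntry (n m) (ε m) k * v.repr z (.inl ⟨m, k⟩)) := by
          rw [← pow_add, Nat.add_sub_cancel' hlt.le]
          convert h using 1
          simp only [jordanWeight, Sum.elim_inl]
          ring
        rw [mul_dvd_mul_iff_left (pow_ne_zero _ (by simp [(Fact.out : p.Prime).ne_zero]))] at h'
        exact (u.isUnit.mul (isUnit_jordanEntry (hε m) _ k)).dvd_mul_left.1 h'
      obtain ⟨cx, hcx⟩ := key x hx
      obtain ⟨cy, hcy⟩ := key y hy
      rw [hcx, hcy]
      refine (pow_dvd_pow _ (show i + 1 ≤ m + (i - m) + (i - m) by omega)).trans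
        ⟨u * jordanEntry (n m) (ε m) k * cx * cy, ?_⟩
      simp only [jordanWeight, Sum.elim_inl]
      ring
    · refine (pow_dvd_pow _ (show i + 1 ≤ m from hgt)).trans
        ⟨u * jordanEntry (n m) (ε m) k * v.repr x (.inl ⟨m, k⟩) * v.repr y (.inl ⟨m, k⟩), ?_⟩
      simp only [jordanWeight, Sum.elim_inl]
      ring
  · simp [jordanWeight]

end Jordan

/-! ### Comparison of two coverings -/

section Covering

variable {p : ℕ} [Fact p.Prime] {t : ℕ} {A : Type*} [NonUnitalCommRing A] [Module ℤ_[p] A]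
  [IsScalarTower ℤ_[p] A A] [SMulCommClass ℤ_[p] A A]
  {M : Type*} [AddCommGroup M] [Module ℤ_[p] M] {N : Type*} [AddCommGroup N] [Module ℤ_[p] N]

/-- The forms of two coverings `π : M → A / Ann(A)` and `ρ : N → A / Ann(A)` agree modulo `p ^ t`
and up to a unit, on vectors with the same images in `A / Ann(A)`. -/
theorem IsCovering.exists_unit_congr {b : LinearMap.BilinForm ℤ_[p] M}
    {g : LinearMap.BilinForm ℤ_[p] N} (ht : 0 < t) (hb : IsCovering p t A b)
    (hg : IsCovering p t A g) :
    ∃ (π : M →ₗ[ℤ_[p]] (A ⧸ algAnn ℤ_[p] A)) (ρ : N →ₗ[ℤ_[p]] (A ⧸ algAnn ℤ_[p] A)) (w : ℤ_[p]),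
      Function.Surjective π ∧ Function.Surjective ρ ∧ PadicInt.toZMod w ≠ 0 ∧
      ∀ x x' z z', ρ z = π x → ρ z' = π x' → (p : ℤ_[p]) ^ t ∣ g z z' - w * b x x' := by
  obtain ⟨-, π, hπ, φ, hφ⟩ := hb
  obtain ⟨-, ρ, hρ, ψ, hψ⟩ := hg
  let I : Ideal ℤ_[p] := Ideal.span {(p : ℤ_[p]) ^ t}
  let θ : (ℤ_[p] ⧸ I) ≃ₗ[ℤ_[p]] (ℤ_[p] ⧸ I) := φ.trans ψ.symm
  -- A linear map out of `ℤ_p / p ^ t` is determined by the image of `1`.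
  have hlin : ∀ (θ : (ℤ_[p] ⧸ I) ≃ₗ[ℤ_[p]] (ℤ_[p] ⧸ I)) (a c : ℤ_[p]),
      θ (Ideal.Quotient.mk I 1) = Ideal.Quotient.mk I c →
        θ (Ideal.Quotient.mk I a) = Ideal.Quotient.mk I (c * a) := by
    intro θ a c h
    have h1 : ∀ c : ℤ_[p], Ideal.Quotient.mk I (c * a) = a • Ideal.Quotient.mk I c := by
      intro c
      rw [mul_comm]
      rfl
    rw [← one_mul a, h1, map_smul, h, ← h1, one_mul]
  obtain ⟨w, hw⟩ := Ideal.Quotient.mk_surjective (I := I) (θ (Ideal.Quotient.mk I 1))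
  obtain ⟨w', hw'⟩ := Ideal.Quotient.mk_surjective (I := I) (θ.symm (Ideal.Quotient.mk I 1))
  refine ⟨π, ρ, w, hπ, hρ, fun h0 => ?_, fun x x' z z' h h' => ?_⟩
  · have h1 := hlin θ.symm w w' hw'.symm
    rw [hw, LinearEquiv.symm_apply_apply, Ideal.Quotient.eq, Ideal.mem_span_singleton] at h1
    have h2 := (PadicInt.toZMod_eq_zero_iff _).2 ((dvd_pow_self (p : ℤ_[p]) ht.ne').trans h1)
    simp [h0] at h2
  · have h1 := hlin θ (b x x') w hw.symm
    rw [← Ideal.mem_span_singleton, ← Ideal.Quotient.eq, ← h1]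
    apply ψ.injective
    rw [hψ, h, h', ← hφ]
    exact (ψ.apply_symm_apply _).symm

/-- The diagonal forms over `ZMod p` belonging to the `i`-th Jordan components of two coverings:
up to scalars, nonzero for the first form, the first is the pullback of the second by a linear
map. -/
theorem exists_matrix_congr {b : LinearMap.BilinForm ℤ_[p] M} {g : LinearMap.BilinForm ℤ_[p] N}
    [Module.Finite ℤ_[p] M] [Module.Finite ℤ_[p] N]
    (hb : IsCovering p t A b) (hg : IsCovering p t A g)
    {n n' : ℕ → ℕ} {ε ε' : ℕ → ℤ_[p]} (hε' : ∀ i, IsUnit (ε' i)) {r r' : ℕ}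
    {v : Module.Basis ((Σ i : ℕ, Fin (n i)) ⊕ Fin r) ℤ_[p] M} {u : ℤ_[p]ˣ}
    (hv : ∀ j k, b (v j) (v k) = if j = k then u * jordanWeight n ε r j else 0)
    {v' : Module.Basis ((Σ i : ℕ, Fin (n' i)) ⊕ Fin r') ℤ_[p] N} {u' : ℤ_[p]ˣ}
    (hv' : ∀ j k, g (v' j) (v' k) = if j = k then u' * jordanWeight n' ε' r' j else 0)
    {i : ℕ} (hi : i < t) :
    ∃ (s s' : ZMod p) (F : Matrix (Fin (n' i)) (Fin (n i)) (ZMod p)), s ≠ 0 ∧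
      s • Matrix.diagonal (jordanEntry (n i) (PadicInt.toZMod (ε i))) =
        s' • (F.transpose * Matrix.diagonal (jordanEntry (n' i) (PadicInt.toZMod (ε' i))) * F) := by
  obtain ⟨π, ρ, w, hπ, hρ, hw, hgb⟩ := hb.exists_unit_congr (by omega) hg
  have hsymm := hb.1
  have := Module.Finite.finite_basis v
  choose z hz using fun k : Fin (n i) => hρ (π (v (.inl ⟨i, k⟩)))
  have hpt : (p : ℤ_[p]) ^ i ∣ p ^ t := pow_dvd_pow _ hi.le
  -- `ρ y` is also the image of some `x : M`, so `g (z k) y ≡ w * b (v k) x` modulo `p ^ t`.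
  have hzdvd : ∀ k y, (p : ℤ_[p]) ^ i ∣ g (z k) y := by
    intro k y
    obtain ⟨x, hx⟩ := hπ (ρ y)
    rw [dvd_iff_dvd_of_dvd_sub (hpt.trans (hgb _ _ _ _ (hz k) hx.symm))]
    refine dvd_mul_of_dvd_right (?_ : _ ∣ b (v _) x) _
    rw [hsymm, LinearMap.BilinForm.apply_basis_of_diagonal hv]
    refine ⟨u * jordanEntry (n i) (ε i) k * v.repr x (.inl ⟨i, k⟩), ?_⟩
    simp only [jordanWeight, Sum.elim_inl]
    ring
  refine ⟨PadicInt.toZMod (w * u), PadicInt.toZMod (u' : ℤ_[p]),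
    .of fun l k => PadicInt.toZMod (v'.repr (z k) (.inl ⟨i, l⟩)), ?_, ?_⟩
  · rw [map_mul]
    exact mul_ne_zero hw (PadicInt.toZMod_ne_zero_of_isUnit u.isUnit)
  · ext k l
    have h1 := hgb _ _ _ _ (hz k) (hz l)
    have h2 := pow_succ_dvd_apply_sub_sum hε' hv' (hzdvd k) (hzdvd l)
    have h3 := dvd_sub h2 ((pow_dvd_pow _ (show i + 1 ≤ t from hi)).trans h1)
    have h4 : (p : ℤ_[p]) ^ i * p ∣ p ^ i *
        (w * (u * Matrix.diagonal (jordanEntry (n i) (ε i)) k l) -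
          ∑ m : Fin (n' i), u' * jordanEntry (n' i) (ε' i) m *
            v'.repr (z k) (.inl ⟨i, m⟩) * v'.repr (z l) (.inl ⟨i, m⟩)) := by
      rw [← pow_succ]
      convert h3 using 1
      rw [hv]
      by_cases hkl : k = l
      · subst hkl
        simp only [if_true, jordanWeight, Sum.elim_inl, Matrix.diagonal_apply_eq]
        ring
      · rw [if_neg (by simpa using hkl), Matrix.diagonal_apply_ne _ hkl]
        ring
    rw [mul_dvd_mul_iff_left (pow_ne_zero _ (by simp [(Fact.out : p.Prime).ne_zero])),
      ← PadicInt.toZMod_eq_zero_iff, map_sub, sub_eq_zero] at h4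
    have hdiag : PadicInt.toZMod (Matrix.diagonal (jordanEntry (n i) (ε i)) k l) =
        Matrix.diagonal (jordanEntry (n i) (PadicInt.toZMod (ε i))) k l := by
      by_cases hkl : k = l
      · subst hkl
        simp [map_jordanEntry]
      · simp [Matrix.diagonal_apply_ne _ hkl]
    rw [map_mul, map_mul, hdiag, map_sum] at h4
    rw [Matrix.smul_apply, smul_eq_mul, map_mul, mul_assoc, h4, Matrix.smul_apply,
      Matrix.mul_apply, Finset.smul_sum]
    refine Finset.sum_congr rfl fun m _ => ?_
    simp only [map_mul, map_jordanEntry, Matrix.mul_diagonal, Matrix.transpose_apply,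
      Matrix.of_apply, smul_eq_mul]
    ring

variable {n n' : ℕ} {s s' ε ε' : ZMod p} {F : Matrix (Fin n') (Fin n) (ZMod p)}

theorem le_of_matrix_congr (hs : s ≠ 0) (hε : ε ≠ 0)
    (h : s • Matrix.diagonal (jordanEntry n ε) =
      s' • (F.transpose * Matrix.diagonal (jordanEntry n' ε') * F)) : n ≤ n' := by
  have hunit : IsUnit (s • Matrix.diagonal (jordanEntry n ε)) := by
    rw [Matrix.isUnit_iff_isUnit_det, Matrix.det_smul, Matrix.det_diagonal, isUnit_iff_ne_zero]
    exact mul_ne_zero (pow_ne_zero _ hs) (Finset.prod_ne_zero_iff.2 fun k _ =>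
      (isUnit_jordanEntry hε.isUnit n k).ne_zero)
  have hrank := Matrix.rank_of_isUnit _ hunit
  rw [h, ← Matrix.smul_mul, Fintype.card_fin] at hrank
  rw [← hrank]
  exact (Matrix.rank_mul_le_right _ _).trans (by simpa using Matrix.rank_le_card_height F)

/-- The determinants give `s ^ n * ε = s' ^ n * ε' * det F ^ 2`, where `n` is even. -/
theorem isSquare_mul_of_matrix_congr (hnn' : n = n') (hn : Even n) (hn0 : n ≠ 0) (hs : s ≠ 0)
    (h : s • Matrix.diagonal (jordanEntry n ε) =
      s' • (F.transpose * Matrix.diagonal (jordanEntry n' ε') * F)) : IsSquare (ε * ε') := by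
  subst hnn'
  have hdet := congrArg Matrix.det h
  simp only [Matrix.det_smul, Matrix.det_mul, Matrix.det_diagonal, Matrix.det_transpose,
    prod_jordanEntry hn0, Fintype.card_fin] at hdet
  obtain ⟨m, rfl⟩ := hn
  have hsm : s ^ m ≠ 0 := pow_ne_zero _ hs
  refine ⟨s' ^ m * ε' * F.det / s ^ m, ?_⟩
  rw [pow_add, pow_add] at hdet
  field_simp
  linear_combination ε' * hdet

end Covering

theorem mainTheorem6 (p : ℕ) [Fact p.Prime] (hp : p ≠ 2)
    -- the pre-selected non-square unit
    (q : ℤ_[p]) (hq : IsUnit q) (hq' : ¬ IsSquare q)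
    -- a commutative 3-nilpotent torsion algebra with cyclic square
    (A : Type*) [NonUnitalCommRing A] [Module ℤ_[p] A]
    [IsScalarTower ℤ_[p] A A] [SMulCommClass ℤ_[p] A A] [Module.Finite ℤ_[p] A]
    (htors : Module.IsTorsion ℤ_[p] A) (hnil : ∀ x y z : A, x * y * z = 0)
    (t : ℕ) (ht : 0 < t)
    (hsq : Nonempty (algSq ℤ_[p] A ≃ₗ[ℤ_[p]] (ℤ_[p] ⧸ Ideal.span {(p : ℤ_[p]) ^ t})))
    -- two coverings
    (M : Type*) [AddCommGroup M] [Module ℤ_[p] M] [Module.Finite ℤ_[p] M] [Module.Free ℤ_[p] M]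
    (N : Type*) [AddCommGroup N] [Module ℤ_[p] N] [Module.Finite ℤ_[p] N] [Module.Free ℤ_[p] N]
    (b : LinearMap.BilinForm ℤ_[p] M) (g : LinearMap.BilinForm ℤ_[p] N)
    (hb : IsCovering p t A b) (hg : IsCovering p t A g)
    -- their Jordan decompositions modulo `p ^ t`
    (bJ gJ : Fin t → FormMatrix p)
    (hbJ : IsJordanDecompositionMod q t b bJ) (hgJ : IsJordanDecompositionMod q t g gJ) :
    (∀ i : Fin t, (bJ i).rk = (gJ i).rk) ∧
    (∀ i : Fin t, Even (bJ i).rk → bJ i = gJ i) := by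
  obtain ⟨c, hc, hcJ⟩ := hbJ
  obtain ⟨c', hc', hcJ'⟩ := hgJ
  obtain ⟨ε, hε, r, v, u, hv⟩ := hc.exists_diagonal
  obtain ⟨ε', hε', r', v', u', hv'⟩ := hc'.exists_diagonal
  have hunit : ∀ {x : ℤ_[p]}, x = 1 ∨ x = q → IsUnit x := by
    rintro x (rfl | rfl)
    exacts [isUnit_one, hq]
  have hrk : ∀ i : Fin t, (bJ i).rk = (gJ i).rk := by
    intro i
    rw [hcJ, hcJ']
    obtain ⟨s, s', F, hs, h⟩ :=
      exists_matrix_congr hb hg (fun i => hunit (hε' i).1) hv hv' i.2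
    obtain ⟨s₂, s₂', F₂, hs₂, h₂⟩ :=
      exists_matrix_congr hg hb (fun i => hunit (hε i).1) hv' hv i.2
    exact le_antisymm
      (le_of_matrix_congr hs (PadicInt.toZMod_ne_zero_of_isUnit (hunit (hε i).1)) h)
      (le_of_matrix_congr hs₂ (PadicInt.toZMod_ne_zero_of_isUnit (hunit (hε' i).1)) h₂)
  refine ⟨hrk, fun i hev => ?_⟩
  have hn : (c i).1 = (c' i).1 := by
    rw [← hcJ, ← hcJ']
    exact hrk i
  rw [hcJ] at hev
  rw [hcJ, hcJ']
  by_cases hn0 : (c i).1 = 0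
  · exact FormMatrix.eq_of_eq_jordanBlock hn (hε i).2
      ((hε' i).2.trans (jordanBlock_eq_of_eq_zero (hn ▸ hn0) _ _ _))
  obtain ⟨s, s', F, hs, h⟩ :=
    exists_matrix_congr hb hg (fun i => hunit (hε' i).1) hv hv' i.2
  have hsqmod := isSquare_mul_of_matrix_congr hn hev hn0 hs h
  rw [← map_mul] at hsqmod
  have hsqmul : IsSquare (ε i * ε' i) := PadicInt.isSquare_of_isSquare_toZMod hp
    ((hunit (hε i).1).mul (hunit (hε' i).1)) hsqmod
  have heq : ε i = ε' i := by
    rcases (hε i).1 with h1 | h1 <;> rcases (hε' i).1 with h2 | h2 <;> rw [h1, h2] at hsqmul ⊢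
    · exact absurd (by simpa using hsqmul) hq'
    · exact absurd (by simpa using hsqmul) hq'
  exact FormMatrix.eq_of_eq_jordanBlock hn (hε i).2 (heq ▸ (hε' i).2)
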